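/- Let $p$ be a prime and $P$ a finite $p$-group. Let $\mathcal F$ be a saturated fusion system on $P$, that is, a category whose objects are the subgroups of $P$, whose morphism sets $\mathrm{Hom}_{\mathcal F}(Q,R)$ consist of injective group homomorphisms $Q\to R$ (composed as usual), and such that for all $Q,R\le P$: (a) if $Q\le R$, the inclusion $Q\to R$ is in $\mathcal F$; (b) if $\varphi\in\mathrm{Hom}_{\mathcal F}(Q,R)$, then the induced isomorphism $Q\to\varphi(Q)$ and its inverse are in $\mathcal F$; (c) every homomorphism $Q\to R$ induced by conjugation with an element of $P$ is in $\mathcal F$; (d) $\mathrm{Aut}_P(P)$ is a Sylow $p$-subgroup of $\mathrm{Aut}_{\mathcal F}(P)$; (e) if $\varphi\in\mathrm{Hom}_{\mathcal F}(Q,P)$ and $|N_P(\varphi(Q))|\ge|N_P(R)|$ for every $R$ that is $\mathcal F$-isomorphic to $\varphi(Q)$, then $\varphi$ extends to a morphism in $\mathrm{Hom}_{\mathcal F}(N_\varphi,P)$, where $N_\varphi$ is the inverse image in $N_P(Q)$ of $\mathrm{Aut}_P(Q)\cap\varphi^{-1}\mathrm{Aut}_P(\varphi(Q))\varphi$. Here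 $\mathrm{Aut}_P(Q)$ is the group of automorphisms of $Q$ induced by conjugation with elements of $N_P(Q)$. For $Q\le P$ put $$[Q,\mathcal F]=\langle x^{-1}\varphi(x)\mid x\in Q,\ \varphi\in\mathrm{Hom}_{\mathcal F}(\langle x\rangle,Q)\rangle ,$$ $[P,\mathcal F;0]=P$, $[P,\mathcal F;i]=[[P,\mathcal F;i-1],\mathcal F]$ for $i\ge1$, and $[P,\mathcal F;\infty]=\bigcap_{i\ge0}[P,\mathcal F;i]$. If $[P,\mathcal F;\infty]=1$, then $\mathcal F=\mathcal F_P(P)$, the fusion system in which $\mathrm{Hom}(Q,R)$ is the set of all homomorphisms $Q\to R$ induced by conjugation with elements of $P$. -/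

import Mathlib

/-- A category whose objects are the subgroups of `P` and whose morphisms `Q ⟶ R` form a set of
injective group homomorphisms `Q →* R`, composed as usual. -/
@[ext]
structure FusionCategory (P : Type*) [Group P] where
  /-- The set of morphisms from `Q` to `R`. -/
  Hom : (Q R : Subgroup P) → Set (Q →* R)
  injective : ∀ {Q R : Subgroup P} {φ : Q →* R}, φ ∈ Hom Q R → Function.Injective φ
  id_mem : ∀ Q : Subgroup P, MonoidHom.id Q ∈ Hom Q Q
  comp_mem : ∀ {Q R S : Subgroup P} {φ : Q →* R} {ψ : R →* S},
    φ ∈ Hom Q R → ψ ∈ Hom R S → ψ.comp φ ∈ Hom Q S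

namespace FusionCategory

/-- The set `Hom_P(Q, R)` of homomorphisms `Q → R` induced by conjugation with an element
of `P`. -/
def conjHom {P : Type*} [Group P] (Q R : Subgroup P) : Set (Q →* R) :=
  {φ | ∃ g : P, ∀ x : Q, (φ x : P) = g * x * g⁻¹}

/-- The image `φ(Q)`, as a subgroup of `P`. -/
def image {P : Type*} [Group P] {Q R : Subgroup P} (φ : Q →* R) : Subgroup P :=
  (R.subtype.comp φ).range

/-- The homomorphism `Q → φ(Q)` induced by `φ`. -/
def toImage {P : Type*} [Group P] {Q R : Subgroup P} (φ : Q →* R) : Q →* image φ :=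
  (R.subtype.comp φ).rangeRestrict

/-- `Aut_P(Q)`: the automorphisms of `Q` induced by conjugation with elements of `N_P(Q)`. -/
def autP {P : Type*} [Group P] (Q : Subgroup P) : Subgroup (MulAut Q) :=
  Q.normalizerMonoidHom.range

/-- For an injective `φ : Q → R`, the induced isomorphism `Q ≃ φ(Q)`. -/
noncomputable def imageEquiv {P : Type*} [Group P] {Q R : Subgroup P} (φ : Q →* R)
    (hφ : Function.Injective φ) : Q ≃* image φ :=
  MonoidHom.ofInjective (f := R.subtype.comp φ) (R.subtype_injective.comp hφ)

/-- `N_φ`: the inverse image in `N_P(Q)` of `Aut_P(Q) ∩ (φ⁻¹ Aut_P(φ(Q)) φ)`, as a subgroup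
of `P`. -/
noncomputable def extender {P : Type*} [Group P] {Q R : Subgroup P} (φ : Q →* R)
    (hφ : Function.Injective φ) : Subgroup P :=
  ((autP Q ⊓ (autP (image φ)).comap (MulAut.congr (imageEquiv φ hφ)).toMonoidHom).comap
    Q.normalizerMonoidHom).map (Subgroup.normalizer (Q : Set P)).subtype

/-- `Q ≤ N_φ`. -/
theorem le_extender {P : Type*} [Group P] {Q R : Subgroup P} (φ : Q →* R)
    (hφ : Function.Injective φ) : Q ≤ extender φ hφ := by
  intro x hx
  refine ⟨⟨x, Subgroup.le_normalizer hx⟩, ⟨⟨_, rfl⟩, ?_⟩, rfl⟩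
  refine ⟨⟨imageEquiv φ hφ ⟨x, hx⟩, Subgroup.le_normalizer (SetLike.coe_mem _)⟩, ?_⟩
  ext y
  obtain ⟨z, rfl⟩ := (imageEquiv φ hφ).surjective y
  have h1 : Q.normalizerMonoidHom ⟨x, Subgroup.le_normalizer hx⟩ z
      = ⟨x, hx⟩ * z * (⟨x, hx⟩ : Q)⁻¹ := by
    ext; rfl
  have h2 : (MulAut.congr (imageEquiv φ hφ)).toMonoidHom
      (Q.normalizerMonoidHom ⟨x, Subgroup.le_normalizer hx⟩) (imageEquiv φ hφ z)
      = imageEquiv φ hφ (Q.normalizerMonoidHom ⟨x, Subgroup.le_normalizer hx⟩ z) := by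
    simp [MulAut.congr]
  rw [h2, h1, map_mul, map_mul, map_inv]
  rfl

section

variable {P : Type*} [Group P] (F : FusionCategory P)

/-- `Q` and `R` are isomorphic in `F`. -/
def IsIsomorphic (Q R : Subgroup P) : Prop :=
  ∃ φ ∈ F.Hom Q R, ∃ ψ ∈ F.Hom R Q, ψ.comp φ = MonoidHom.id Q ∧ φ.comp ψ = MonoidHom.id R

/-- `|N_P(Q)| ≥ |N_P(R)|` for all `R` in the `F`-isomorphism class of `Q`. -/
def IsFullyNormalized (Q : Subgroup P) : Prop :=
  ∀ R : Subgroup P, F.IsIsomorphic Q R →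
    Nat.card (Subgroup.normalizer (R : Set P)) ≤ Nat.card (Subgroup.normalizer (Q : Set P))

/-- `Aut_F(Q)`: the automorphisms of `Q` in the category `F`. -/
def aut (Q : Subgroup P) : Subgroup (MulAut Q) where
  carrier := {α | α.toMonoidHom ∈ F.Hom Q Q ∧ (α⁻¹).toMonoidHom ∈ F.Hom Q Q}
  one_mem' := ⟨F.id_mem Q, F.id_mem Q⟩
  mul_mem' := fun {a b} ha hb => ⟨F.comp_mem hb.1 ha.1, by
    rw [mul_inv_rev]; exact F.comp_mem ha.2 hb.2⟩
  inv_mem' := fun {a} ha => ⟨ha.2, by rw [inv_inv]; exact ha.1⟩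

/-- `F` is a saturated fusion system on the `p`-group `P`. -/
structure IsSaturated (p : ℕ) : Prop where
  inclusion_mem : ∀ {Q R : Subgroup P} (h : Q ≤ R), Subgroup.inclusion h ∈ F.Hom Q R
  /-- The induced isomorphism from `Q` to `φ(Q)` is in `F`. -/
  toImage_mem : ∀ {Q R : Subgroup P} {φ : Q →* R}, φ ∈ F.Hom Q R →
    toImage φ ∈ F.Hom Q (image φ)
  /-- The inverse of the induced isomorphism from `Q` to `φ(Q)` is in `F`. -/
  symm_mem : ∀ {Q R : Subgroup P} {φ : Q →* R} (h : φ ∈ F.Hom Q R),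
    (imageEquiv φ (F.injective h)).symm.toMonoidHom ∈ F.Hom (image φ) Q
  conjHom_subset : ∀ Q R : Subgroup P, conjHom Q R ⊆ F.Hom Q R
  /-- Sylow axiom: `Aut_P(P)` is a Sylow `p`-subgroup of `Aut_F(P)`. -/
  sylow : ∃ S : Sylow p (F.aut ⊤), (S : Subgroup (F.aut ⊤)).map (F.aut ⊤).subtype = autP ⊤
  /-- Extension axiom: if `φ(Q)` is fully `F`-normalized, then `φ` extends to `N_φ`. -/
  extension : ∀ {Q : Subgroup P} {φ : Q →* (⊤ : Subgroup P)} (h : φ ∈ F.Hom Q ⊤),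
    F.IsFullyNormalized (image φ) →
      ∃ ψ ∈ F.Hom (extender φ (F.injective h)) ⊤,
        ψ.comp (Subgroup.inclusion (le_extender φ (F.injective h))) = φ

/-- `[Q, F] = ⟨x⁻¹ φ(x) ∣ x ∈ Q, φ ∈ Hom_F(⟨x⟩, Q)⟩`; for `Q = P` this is the focal subgroup
of `F`. -/
def focal (Q : Subgroup P) : Subgroup P :=
  Subgroup.closure {y | ∃ x ∈ Q, ∃ φ ∈ F.Hom (Subgroup.zpowers x) Q,
    y = x⁻¹ * (φ ⟨x, Subgroup.mem_zpowers x⟩ : P)}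

/-- `[Q, F; i]`. -/
def iterFocal (Q : Subgroup P) : ℕ → Subgroup P
  | 0 => Q
  | i + 1 => F.focal (iterFocal Q i)

/-- `[Q, F; ∞]`. -/
def focalInfty (Q : Subgroup P) : Subgroup P :=
  ⨅ i : ℕ, F.iterFocal Q i

end

/-- `F_P(P)`: the morphisms are the homomorphisms induced by conjugation with an element
of `P`. -/
def inner (P : Type*) [Group P] : FusionCategory P where
  Hom := conjHom
  injective := by
    rintro Q R φ ⟨g, hg⟩ x y hxy
    have h : g * (x : P) * g⁻¹ = g * y * g⁻¹ := by rw [← hg, ← hg, hxy]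
    exact Subtype.ext (mul_left_cancel (mul_right_cancel h))
  id_mem := fun Q => ⟨1, fun x => by simp⟩
  comp_mem := by
    rintro Q R S φ ψ ⟨g, hg⟩ ⟨h, hh⟩
    exact ⟨h * g, fun x => by
      rw [MonoidHom.comp_apply, hh, hg, mul_inv_rev]
      simp only [mul_assoc]⟩

end FusionCategory

namespace FusionCategory

section

variable {P : Type*} [Group P] {F : FusionCategory P} {p : ℕ}

/-! The series `[P, F; i]` is strongly closed, every morphism acts trivially on its factors, and it
reaches `1` since `P` is finite. So `Aut_F(R)` stabilizes the chain `R ∩ [P, F; i]` and is a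
`p`-group (`isPGroup_aut`).

It remains to prove a Frobenius-type criterion (`isConj`): if all `Aut_F(R)` are `p`-groups, then
every morphism is a conjugation. This is a descending induction on `|Q|`. The Sylow axiom handles `Q
= P`. For `Q < P`, a morphism that extends to `N_P(Q) > Q` is a conjugation by induction. Growth of
normalizers in `p`-groups then gives `Aut_F(Q) = Aut_P(Q)` for fully normalized `Q` (`aut_le_autP`),
which supplies the extensions needed for all other morphisms. -/

theorem mem_image {Q R : Subgroup P} {φ : Q →* R} {y : P} :
    y ∈ image φ ↔ ∃ x : Q, (φ x : P) = y := Iff.rfl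

/-- Membership in `F` depends only on the underlying map into `P`. -/
theorem IsSaturated.mem_of_coe_eq (hF : F.IsSaturated p) {Q R S : Subgroup P} {φ : Q →* R}
    (hφ : φ ∈ F.Hom Q R) {ψ : Q →* S} (h : ∀ x, (ψ x : P) = φ x) : ψ ∈ F.Hom Q S := by
  have hle : image φ ≤ S := by
    rintro y ⟨x, rfl⟩
    change (φ x : P) ∈ S
    rw [← h]
    exact (ψ x).2
  have := F.comp_mem (hF.toImage_mem hφ) (hF.inclusion_mem hle)
  convert this
  ext x
  exact h x

/-- A map which undoes a morphism of `F` is a morphism of `F`. -/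
theorem IsSaturated.mem_of_inverse (hF : F.IsSaturated p) {Q R S T : Subgroup P} {φ : Q →* R}
    (hφ : φ ∈ F.Hom Q R) {ψ : S →* T} (h : ∀ s : S, ∃ x : Q, (φ x : P) = s ∧ (ψ s : P) = x) :
    ψ ∈ F.Hom S T := by
  have hle : S ≤ image φ := fun s hs => (h ⟨s, hs⟩).imp fun x hx => hx.1
  refine hF.mem_of_coe_eq (F.comp_mem (hF.inclusion_mem hle) (hF.symm_mem hφ)) fun s => ?_
  obtain ⟨x, hx, hs⟩ := h s
  rw [hs]
  have : Subgroup.inclusion hle s = imageEquiv φ (F.injective hφ) x := Subtype.ext hx.symm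
  simp [this]

theorem IsSaturated.subtype_mem (hF : F.IsSaturated p) (Q : Subgroup P) :
    Subgroup.inclusion (le_top : Q ≤ ⊤) ∈ F.Hom Q ⊤ := hF.inclusion_mem _

theorem IsSaturated.mem_aut (hF : F.IsSaturated p) {Q : Subgroup P} {α : MulAut Q}
    (h : α.toMonoidHom ∈ F.Hom Q Q) : α ∈ F.aut Q :=
  ⟨h, hF.mem_of_inverse h fun s : Q => ⟨α⁻¹ s, by simp, rfl⟩⟩

theorem IsSaturated.autP_le_aut (hF : F.IsSaturated p) (Q : Subgroup P) : autP Q ≤ F.aut Q := by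
  rintro _ ⟨g, rfl⟩
  exact hF.mem_aut (hF.conjHom_subset Q Q ⟨g, fun x => rfl⟩)

theorem isIsomorphic_refl (F : FusionCategory P) (Q : Subgroup P) : F.IsIsomorphic Q Q :=
  ⟨_, F.id_mem Q, _, F.id_mem Q, rfl, rfl⟩

theorem IsIsomorphic.trans {Q R S : Subgroup P} (h : F.IsIsomorphic Q R)
    (h' : F.IsIsomorphic R S) : F.IsIsomorphic Q S := by
  obtain ⟨φ, hφ, ψ, hψ, h1, h2⟩ := h
  obtain ⟨φ', hφ', ψ', hψ', h1', h2'⟩ := h'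
  refine ⟨_, F.comp_mem hφ hφ', _, F.comp_mem hψ' hψ, ?_, ?_⟩
  · rw [MonoidHom.comp_assoc, ← MonoidHom.comp_assoc φ, h1', MonoidHom.id_comp, h1]
  · rw [MonoidHom.comp_assoc, ← MonoidHom.comp_assoc ψ', h2, MonoidHom.id_comp, h2']

theorem card_image {Q R : Subgroup P} {φ : Q →* R} (hφ : Function.Injective φ) :
    Nat.card (image φ) = Nat.card Q := (Nat.card_congr (imageEquiv φ hφ).toEquiv).symm

theorem exists_isIsomorphic_isFullyNormalized [Finite P] (F : FusionCategory P)
    (Q : Subgroup P) : ∃ R, F.IsIsomorphic Q R ∧ F.IsFullyNormalized R := by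
  obtain ⟨R, hR, hmax⟩ := Set.exists_max_image {R | F.IsIsomorphic Q R}
    (fun R => Nat.card (Subgroup.normalizer (R : Set P))) (Set.toFinite _)
    ⟨Q, F.isIsomorphic_refl Q⟩
  exact ⟨R, hR, fun S hS => hmax S (IsIsomorphic.trans hR hS)⟩

/-! ### The series of iterated focal subgroups -/

theorem focal_le (F : FusionCategory P) (Q : Subgroup P) : F.focal Q ≤ Q := by
  refine (Subgroup.closure_le _).2 ?_
  rintro y ⟨x, hx, φ, -, rfl⟩
  exact Q.mul_mem (Q.inv_mem hx) (φ _).2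

theorem IsSaturated.inv_mul_mem_focal (hF : F.IsSaturated p) {Q R S : Subgroup P} {φ : R →* S}
    (hφ : φ ∈ F.Hom R S) {x : R} (hx : (x : P) ∈ Q) (hx' : (φ x : P) ∈ Q) :
    (x : P)⁻¹ * φ x ∈ F.focal Q := by
  have hle : Subgroup.zpowers (x : P) ≤ R := by simp
  have hmem := F.comp_mem (hF.inclusion_mem hle) hφ
  have hQ : ∀ y, ((S.subtype.comp (φ.comp (Subgroup.inclusion hle))) y : P) ∈ Q := by
    rintro ⟨_, k, rfl⟩
    have : Subgroup.inclusion hle ⟨(x : P) ^ k, k, rfl⟩ = x ^ k := Subtype.ext (by simp)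
    simpa [this] using Q.zpow_mem hx' k
  exact Subgroup.subset_closure ⟨x, hx, _,
    hF.mem_of_coe_eq (ψ := (S.subtype.comp (φ.comp (Subgroup.inclusion hle))).codRestrict Q hQ)
      hmem fun _ => rfl, rfl⟩

/-- The subgroups `[P, F; i]` are strongly closed in `F`. -/
theorem IsSaturated.apply_mem_iterFocal (hF : F.IsSaturated p) {R S : Subgroup P} {φ : R →* S}
    (hφ : φ ∈ F.Hom R S) (i : ℕ) {x : R} (hx : (x : P) ∈ F.iterFocal ⊤ i) :
    (φ x : P) ∈ F.iterFocal ⊤ i := by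
  induction i with
  | zero => trivial
  | succ i ih =>
    have hx' := F.focal_le _ hx
    -- Write `φ(x) = x · x⁻¹φ(x)`; the second factor is a generator of the next term.
    rw [← mul_inv_cancel_left (x : P) (φ x)]
    exact Subgroup.mul_mem _ hx (hF.inv_mul_mem_focal hφ hx' (ih hx'))

/-- Morphisms of `F` act trivially on `[P, F; i] / [P, F; i + 1]`. -/
theorem IsSaturated.inv_mul_mem_iterFocal (hF : F.IsSaturated p) {R S : Subgroup P}
    {φ : R →* S} (hφ : φ ∈ F.Hom R S) (i : ℕ) {x : R} (hx : (x : P) ∈ F.iterFocal ⊤ i) :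
    (x : P)⁻¹ * φ x ∈ F.iterFocal ⊤ (i + 1) :=
  hF.inv_mul_mem_focal hφ hx (hF.apply_mem_iterFocal hφ i hx)

theorem exists_iterFocal_eq_bot [Finite P] (h : F.focalInfty (⊤ : Subgroup P) = ⊥) :
    ∃ n, F.iterFocal ⊤ n = ⊥ := by
  have hanti : Antitone (F.iterFocal ⊤) := antitone_nat_of_succ_le fun i => F.focal_le _
  obtain ⟨n, hn⟩ := WellFoundedGT.monotone_chain_condition
    (α := (Subgroup P)ᵒᵈ) ⟨fun i => OrderDual.toDual (F.iterFocal ⊤ i), hanti⟩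
  refine ⟨n, eq_bot_iff.2 (h ▸ le_iInf fun m => ?_)⟩
  rcases le_total n m with hm | hm
  · exact (OrderDual.toDual.injective (hn m hm)).le
  · exact hanti hm

/-! ### Automorphism groups are `p`-groups -/

/-- If `β ∈ Aut_F(R)` fixes `R ∩ [P, F; i + 1]` pointwise, then `β ^ |P|` fixes `R ∩ [P, F; i]`
pointwise. -/
theorem IsSaturated.pow_card_apply (hF : F.IsSaturated p) {R : Subgroup P}
    {β : MulAut R} (hβ : β ∈ F.aut R) {i : ℕ}
    (hfix : ∀ x : R, (x : P) ∈ F.iterFocal ⊤ (i + 1) → β x = x) {x : R}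
    (hx : (x : P) ∈ F.iterFocal ⊤ i) : (β ^ Nat.card P) x = x := by
  have hy := hF.inv_mul_mem_iterFocal hβ.1 i hx
  have hfy : β (x⁻¹ * β x) = x⁻¹ * β x := hfix (x⁻¹ * β x) hy
  -- Since `β` fixes `y = x⁻¹β(x)`, each application of `β` multiplies by one more `y`, and `y ^ |P|
  -- = 1`.
  have key : ∀ k : ℕ, (β ^ k) x = x * (x⁻¹ * β x) ^ k := by
    intro k
    induction k with
    | zero => simp
    | succ k ih => rw [pow_succ', MulAut.mul_apply, ih, map_mul, map_pow, hfy, pow_succ', ← mul_assoc x,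
      mul_inv_cancel_left]
  rw [key]
  have : (x⁻¹ * β x) ^ Nat.card P = 1 := Subtype.ext (by simp)
  rw [this, mul_one]

theorem IsSaturated.pow_card_pow_eq_one (hF : F.IsSaturated p) {n : ℕ}
    (hn : F.iterFocal ⊤ n = ⊥) {R : Subgroup P} {α : MulAut R} (hα : α ∈ F.aut R) :
    α ^ Nat.card P ^ n = 1 := by
  -- Climb the series from its trivial term; each step up costs a factor `|P|` in the exponent.
  have key : ∀ j ≤ n, ∀ x : R, (x : P) ∈ F.iterFocal ⊤ (n - j) →
      (α ^ Nat.card P ^ j) x = x := by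
    intro j
    induction j with
    | zero =>
      intro _ x hx
      rw [Nat.sub_zero, hn, Subgroup.mem_bot] at hx
      rw [show x = 1 from Subtype.ext hx, map_one]
    | succ j ih =>
      intro hj x hx
      rw [pow_succ, pow_mul]
      refine hF.pow_card_apply (pow_mem hα _) (i := n - (j + 1)) (fun y hy => ?_) hx
      rw [show n - (j + 1) + 1 = n - j by omega] at hy
      exact ih (by omega) y hy
  ext x
  rw [key n le_rfl x (by rw [Nat.sub_self]; trivial)]
  rfl

theorem IsSaturated.isPGroup_aut [Finite P] (hp : p.Prime) (hP : IsPGroup p P)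
    (hF : F.IsSaturated p) (h : F.focalInfty (⊤ : Subgroup P) = ⊥) (R : Subgroup P) :
    IsPGroup p (F.aut R) := by
  have := Fact.mk hp
  obtain ⟨n, hn⟩ := exists_iterFocal_eq_bot h
  obtain ⟨k, hk⟩ := IsPGroup.iff_card.1 hP
  intro α
  refine ⟨k * n, Subtype.ext ?_⟩
  have := hF.pow_card_pow_eq_one hn α.2
  rwa [hk, ← pow_mul] at this

/-! ### Morphisms are conjugations -/

/-- A sufficient criterion for membership in `N_φ`. -/
theorem mem_extender {Q R : Subgroup P} {φ : Q →* R} (hφ : Function.Injective φ)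
    (g : Subgroup.normalizer (Q : Set P))
    (h : MulAut.congr (imageEquiv φ hφ) (Q.normalizerMonoidHom g) ∈ autP (image φ)) :
    (g : P) ∈ extender φ hφ :=
  ⟨g, ⟨⟨g, rfl⟩, h⟩, rfl⟩

theorem IsSaturated.congr_mem_aut (hF : F.IsSaturated p) {Q R : Subgroup P} {φ : Q →* R}
    (hφ : φ ∈ F.Hom Q R) {α : MulAut Q} (hα : α ∈ F.aut Q) :
    MulAut.congr (imageEquiv φ (F.injective hφ)) α ∈ F.aut (image φ) :=
  hF.mem_aut (F.comp_mem (F.comp_mem (hF.symm_mem hφ) hα.1) (hF.toImage_mem hφ))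

/-- Every morphism from `Q` to `P` in `F` is induced by conjugation with an element of `P`. -/
def IsConj (F : FusionCategory P) (Q : Subgroup P) : Prop := F.Hom Q ⊤ ⊆ conjHom Q ⊤

theorem card_lt_card_normalizer [Finite P] (hp : p.Prime) (hP : IsPGroup p P)
    {Q : Subgroup P} (hQ : Q ≠ ⊤) :
    Nat.card Q < Nat.card (Subgroup.normalizer (Q : Set P)) := by
  have := Fact.mk hp
  have := hP.isNilpotent
  have hlt : Q < Subgroup.normalizer (Q : Set P) :=
    Group.normalizerCondition_of_isNilpotent Q hQ.lt_top
  exact Set.ncard_lt_ncard hlt (Set.toFinite _)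

/-- A morphism with fully normalized image which extends to `N_P(Q)` is a conjugation, if all
morphisms on larger subgroups are. -/
theorem IsSaturated.mem_conjHom_of_normalizer_le [Finite P] (hp : p.Prime) (hP : IsPGroup p P)
    (hF : F.IsSaturated p) {Q : Subgroup P} (hQ : Q ≠ ⊤)
    (ih : ∀ S : Subgroup P, Nat.card Q < Nat.card S → F.IsConj S)
    {φ : Q →* (⊤ : Subgroup P)} (hφ : φ ∈ F.Hom Q ⊤) (hn : F.IsFullyNormalized (image φ))
    (hle : Subgroup.normalizer (Q : Set P) ≤ extender φ (F.injective hφ)) :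
    φ ∈ conjHom Q ⊤ := by
  obtain ⟨ψ, hψ, hψφ⟩ := hF.extension hφ hn
  obtain ⟨g, hg⟩ := ih _ ((card_lt_card_normalizer hp hP hQ).trans_le
    (Subgroup.card_le_of_le hle)) hψ
  exact ⟨g, fun x => by rw [← hψφ]; exact hg _⟩

theorem IsSaturated.aut_top_le [Finite P] (hF : F.IsSaturated p)
    (hA : IsPGroup p (F.aut ⊤)) : F.aut ⊤ ≤ autP ⊤ := by
  obtain ⟨S, hS⟩ := hF.sylow
  have hT : (⊤ : Subgroup (F.aut ⊤)) = S := S.is_maximal' (hA.to_subgroup ⊤) le_top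
  rw [← hS, ← hT]
  intro α hα
  exact ⟨⟨α, hα⟩, trivial, rfl⟩

theorem IsSaturated.isConj_top [Finite P] (hF : F.IsSaturated p)
    (hA : IsPGroup p (F.aut ⊤)) : F.IsConj ⊤ := by
  intro φ hφ
  let α : MulAut (⊤ : Subgroup P) :=
    MulEquiv.ofBijective φ (Finite.injective_iff_bijective.1 (F.injective hφ))
  obtain ⟨g, hg⟩ := hF.aut_top_le hA (hF.mem_aut (α := α) hφ)
  exact ⟨g, fun x => (congrArg (fun β : MulAut (⊤ : Subgroup P) => (β x : P)) hg).symm⟩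

/-- For `Q` fully normalized, `Aut_F(Q) = Aut_P(Q)`, if `Aut_F(Q)` is a `p`-group and all
morphisms on larger subgroups are conjugations. -/
theorem IsSaturated.aut_le_autP [Finite P] (hp : p.Prime) (hP : IsPGroup p P)
    (hF : F.IsSaturated p) {Q : Subgroup P} (hA : IsPGroup p (F.aut Q)) (hQ : Q ≠ ⊤)
    (hn : F.IsFullyNormalized Q) (ih : ∀ S : Subgroup P, Nat.card Q < Nat.card S → F.IsConj S) :
    F.aut Q ≤ autP Q := by
  have := Fact.mk hp
  have := hA.isNilpotent
  by_contra hnot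
  have hlt : (autP Q).subgroupOf (F.aut Q) < ⊤ :=
    lt_top_iff_ne_top.2 fun h => hnot (Subgroup.subgroupOf_eq_top.1 h)
  -- A proper subgroup of a nilpotent group is properly contained in its normalizer, so some `α`
  -- outside `Aut_P(Q)` normalizes it.
  obtain ⟨α, hα, hα'⟩ :=
    SetLike.exists_of_lt (Group.normalizerCondition_of_isNilpotent _ hlt)
  refine hα' ?_
  have hmem : (Subgroup.inclusion le_top).comp (α : MulAut Q).toMonoidHom ∈ F.Hom Q ⊤ :=
    F.comp_mem α.2.1 (hF.subtype_mem Q)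
  have him : image ((Subgroup.inclusion (le_top : Q ≤ ⊤)).comp (α : MulAut Q).toMonoidHom) = Q := by
    ext y
    rw [mem_image]
    constructor
    · rintro ⟨x, rfl⟩
      exact ((α : MulAut Q) x).2
    · intro hy
      exact ⟨(α : MulAut Q)⁻¹ ⟨y, hy⟩, by simp⟩
  -- As `α` normalizes `Aut_P(Q)`, `N_α` is all of `N_P(Q)`; so `α` is conjugation by some `g`,
  -- contradicting its choice.
  obtain ⟨g, hg⟩ := hF.mem_conjHom_of_normalizer_le hp hP hQ ih hmem (him.symm ▸ hn) (by
    intro g hg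
    have hc : (⟨_, hF.autP_le_aut Q ⟨⟨g, hg⟩, rfl⟩⟩ : F.aut Q) ∈ (autP Q).subgroupOf (F.aut Q) :=
      ⟨⟨g, hg⟩, rfl⟩
    obtain ⟨k, hk⟩ := (Subgroup.mem_normalizer_iff.1 hα _).1 hc
    refine mem_extender (F.injective hmem) ⟨g, hg⟩ ⟨⟨k, by rw [him]; exact k.2⟩, ?_⟩
    ext y
    obtain ⟨z, rfl⟩ := (imageEquiv _ (F.injective hmem)).surjective y
    have := congrArg (fun β : MulAut Q => (β ((α : MulAut Q) z) : P)) hk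
    simp only [MulAut.congr, MulEquiv.coe_mk, Equiv.coe_fn_mk, MulEquiv.trans_apply,
      MulEquiv.symm_apply_apply]
    have hkz : (k : P) * (α : MulAut Q) z * (k : P)⁻¹
        = (α : MulAut Q) (Q.normalizerMonoidHom ⟨g, hg⟩ z) := by simpa using this
    exact hkz)
  have hgQ : g ∈ Subgroup.normalizer (Q : Set P) := by
    have hsub : ∀ x ∈ Q, g * x * g⁻¹ ∈ Q := fun x hx => by
      rw [← hg ⟨x, hx⟩]
      exact ((α : MulAut Q) ⟨x, hx⟩).2
    refine Subgroup.mem_normalizer_iff.2 fun x => ⟨hsub x, fun hx => ?_⟩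
    obtain ⟨y, hy⟩ := (α : MulAut Q).surjective ⟨_, hx⟩
    have h2 : g * (y : P) * g⁻¹ = g * x * g⁻¹ := (hg y).symm.trans (congrArg Subtype.val hy)
    rw [← mul_left_cancel (mul_right_cancel h2)]
    exact y.2
  refine ⟨⟨g, hgQ⟩, ?_⟩
  ext x
  exact (hg x).symm

/-- A morphism onto a fully normalized subgroup is a conjugation, if `F`-automorphism groups are
`p`-groups and all morphisms on larger subgroups are conjugations. -/
theorem IsSaturated.mem_conjHom_of_isFullyNormalized [Finite P] (hp : p.Prime)
    (hP : IsPGroup p P) (hF : F.IsSaturated p) (hA : ∀ R, IsPGroup p (F.aut R))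
    {Q : Subgroup P} (hQ : Q ≠ ⊤)
    (ih : ∀ S : Subgroup P, Nat.card Q < Nat.card S → F.IsConj S)
    {φ : Q →* (⊤ : Subgroup P)} (hφ : φ ∈ F.Hom Q ⊤) (hn : F.IsFullyNormalized (image φ)) :
    φ ∈ conjHom Q ⊤ := by
  have hcard := card_image (F.injective hφ)
  have hR : image φ ≠ ⊤ := by
    intro h
    rw [h, Subgroup.card_top] at hcard
    exact hQ (Subgroup.eq_top_of_card_eq Q hcard.symm)
  have hle := hF.aut_le_autP hp hP (hA _) hR hn (by rwa [hcard])
  -- Transport along `φ` sends `Aut_P(Q)` into `Aut_F(φ(Q)) = Aut_P(φ(Q))`, so `N_φ = N_P(Q)`.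
  refine hF.mem_conjHom_of_normalizer_le hp hP hQ ih hφ hn fun g hg => ?_
  exact mem_extender (F.injective hφ) ⟨g, hg⟩
    (hle (hF.congr_mem_aut hφ (hF.autP_le_aut Q ⟨⟨g, hg⟩, rfl⟩)))

/-- With `ψ` an isomorphism from `φ(Q)` to a fully normalized `R`, both `ψ` and `ψφ` have fully
normalized image, hence are conjugations, and so is `φ = ψ⁻¹(ψφ)`. -/
theorem IsSaturated.isConj_of_card_lt [Finite P] (hp : p.Prime) (hP : IsPGroup p P)
    (hF : F.IsSaturated p) (hA : ∀ R, IsPGroup p (F.aut R)) {Q : Subgroup P} (hQ : Q ≠ ⊤)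
    (ih : ∀ S : Subgroup P, Nat.card Q < Nat.card S → F.IsConj S) : F.IsConj Q := by
  intro φ hφ
  obtain ⟨R, ⟨ψ, hψ, χ, hχ, hχψ, hψχ⟩, hR⟩ :=
    F.exists_isIsomorphic_isFullyNormalized (image φ)
  have hψ' := F.comp_mem hψ (hF.subtype_mem R)
  have hθ := F.comp_mem (hF.toImage_mem hφ) hψ'
  have hcard := card_image (F.injective hφ)
  have hS : image φ ≠ ⊤ := by
    intro h
    rw [h, Subgroup.card_top] at hcard
    exact hQ (Subgroup.eq_top_of_card_eq Q hcard.symm)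
  have him : image ((Subgroup.inclusion (le_top : R ≤ ⊤)).comp ψ) = R := by
    ext y
    constructor
    · rintro ⟨x, rfl⟩
      exact (ψ x).2
    · intro hy
      have := congrArg Subtype.val (DFunLike.congr_fun hψχ ⟨y, hy⟩)
      exact ⟨χ ⟨y, hy⟩, this⟩
  have him' : image (((Subgroup.inclusion (le_top : R ≤ ⊤)).comp ψ).comp (toImage φ)) = R := by
    refine Eq.trans ?_ him
    ext y
    constructor
    · rintro ⟨x, rfl⟩
      exact ⟨toImage φ x, rfl⟩
    · rintro ⟨x, rfl⟩
      obtain ⟨z, rfl⟩ := (imageEquiv φ (F.injective hφ)).surjective x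
      exact ⟨z, rfl⟩
  obtain ⟨a, ha⟩ := hF.mem_conjHom_of_isFullyNormalized hp hP hA hS (by rwa [hcard]) hψ'
    (by rwa [him])
  obtain ⟨b, hb⟩ := hF.mem_conjHom_of_isFullyNormalized hp hP hA hQ ih hθ (by rwa [him'])
  refine ⟨a⁻¹ * b, fun x => ?_⟩
  have h1 : a * (φ x : P) * a⁻¹ = b * x * b⁻¹ := (ha (toImage φ x)).symm.trans (hb x)
  calc (φ x : P) = a⁻¹ * (a * (φ x : P) * a⁻¹) * a := by group
    _ = a⁻¹ * b * x * (a⁻¹ * b)⁻¹ := by rw [h1]; group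

theorem IsSaturated.isConj [Finite P] (hp : p.Prime) (hP : IsPGroup p P)
    (hF : F.IsSaturated p) (hA : ∀ R, IsPGroup p (F.aut R)) (Q : Subgroup P) : F.IsConj Q := by
  induction hn : Nat.card P - Nat.card Q using Nat.strong_induction_on generalizing Q with
  | _ n ih =>
    by_cases hQ : Q = ⊤
    · subst hQ
      exact hF.isConj_top (hA ⊤)
    · refine hF.isConj_of_card_lt hp hP hA hQ fun S hS => ih _ ?_ S rfl
      have := Subgroup.card_le_card_group S
      omega

end

end FusionCategory

theorem mainTheorem6 {p : ℕ} (hp : p.Prime) {P : Type*} [Group P] [Finite P] (hP : IsPGroup p P)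
    (F : FusionCategory P) (hF : F.IsSaturated p)
    (h : F.focalInfty (⊤ : Subgroup P) = ⊥) :
    F = FusionCategory.inner P := by
  ext Q R φ
  refine ⟨fun hφ => ?_, fun hφ => hF.conjHom_subset Q R hφ⟩
  obtain ⟨g, hg⟩ := hF.isConj hp hP (fun S => hF.isPGroup_aut hp hP h S) Q
    (F.comp_mem hφ (hF.subtype_mem R))
  exact ⟨g, hg⟩
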